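/- Let $d\ge 0$, let $\Sigma\in\mathbb R^{d\times d}$ be symmetric positive definite, and let $M_0,M_1\subseteq\mathbb R^d$ be convex. Put $\mathcal P_i=\{\mathcal N(\mu,\Sigma):\mu\in M_i\}$, and let $(\mu_0^*,\mu_1^*)\in M_0\times M_1$ be a minimizer of $(\mu_0-\mu_1)^T\Sigma^{-1}(\mu_0-\mu_1)$ over $\mu_0\in M_0$, $\mu_1\in M_1$ (assumed to exist). Let $$\epsilon^*=\exp\!\Big(-\tfrac18(\mu_0^*-\mu_1^*)^T\Sigma^{-1}(\mu_0^*-\mu_1^*)\Big),$$ let $L^*$ be the log-likelihood ratio (logarithm of the ratio of the Lebesgue densities) of $\mathcal N(\mu_1^*,\Sigma)$ against $\mathcal N(\mu_0^*,\Sigma)$, and for $b\in\mathbb R$ let $$T_1=T_1(b)=\inf\Big\{t\ge 1:\ \max_{1\le k\le t}\ \sum_{i=k}^t\tfrac12L^*(\xi_i)\ge b\Big\}\in\{1,2,\dots\}\cup\{\infty\}$$ for observations $\xi_1,\xi_2,\dots$ in $\mathbb R^d$. For laws $\nu_0,\nu_1$ on $\mathbb R^d$, let $\mathbb E_\infty^{\nu_0}$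 be the expectation when the $\xi_i$ are i.i.d. with law $\nu_0$, and $\mathbb E_k^{\nu_0,\nu_1}$ the expectation when the $\xi_i$ are independent with $\xi_i\sim\nu_0$ for $i<k$ and $\xi_i\sim\nu_1$ for $i\ge k$. With $\mathcal F_n=\sigma(\xi_1,\dots,\xi_n)$, the worst-case detection delay of $T$ is $$\mathrm{WDD}(T)=\sup_{k\ge1}\ \operatorname{ess\,sup}\ \mathbb E_k^{\nu_0,\nu_1}\big[(T-k+1)^+\mid\mathcal F_{k-1}\big]\in[0,\infty].$$ (1) For all $\nu_0\in\mathcal P_0$ and $\nu_1\in\mathcal P_1$, as $b\to\infty$, $$\mathrm{WDD}(T_1(b))\le\frac{b}{1-\epsilon^*}(1+o(1)).$$ (2) There is a choice of thresholds $b=b(\gamma)$, $\gamma>0$, depending only on $\gamma,\Sigma,M_0,M_1,\mu_0^*,\mu_1^*$, such that $\mathbb E_\infty^{\nu_0}[T_1(b(\gamma))]\ge\gamma$ for all $\gamma>0$ and all $\nu_0\in\mathcal P_0$, and such that for all $\nu_0\in\mathcal P_0$ and $\nu_1\in\mathcal P_1$, as $\gamma\to\infty$, $$\mathrm{WDD}(T_1(b(\gamma)))\le\frac{\log\gamma}{1-\epsilon^*}(1+o(1)).$$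 (If $\epsilon^*=1$, i.e. $\mu_0^*=\mu_1^*$, the right-hand sides are read as $+\infty$.) -/

import Mathlib

open MeasureTheory ProbabilityTheory Filter Topology
open scoped ENNReal Matrix

noncomputable section

namespace RobustCusum

/-! Change-point model. Observation sequences `ξ₁, ξ₂, …` in `X` are points `ω : ℕ → X` of the
canonical path space, with `ξ_i = ω (i - 1)` for `i ≥ 1`. -/

/-- The `i`-th observation `ξ_i`, for `i ≥ 1`. -/
def obs {X : Type*} (i : ℕ) (ω : ℕ → X) : X := ω (i - 1)

/-- The law under which `ξ₁, ξ₂, …` are i.i.d. with distribution `ν₀` (no change). -/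
def lawNoChange {X : Type*} [MeasurableSpace X] (ν₀ : Measure X) : Measure (ℕ → X) :=
  Measure.infinitePi fun _ => ν₀

/-- The law under which the observations are independent, `ξ_i ~ ν₀` for `1 ≤ i < k` and
`ξ_i ~ ν₁` for `i ≥ k` (note that `ω j = ξ_{j+1}`). -/
def lawChange {X : Type*} [MeasurableSpace X] (ν₀ ν₁ : Measure X) (k : ℕ) : Measure (ℕ → X) :=
  Measure.infinitePi fun j => if j + 1 < k then ν₀ else ν₁

/-- The σ-algebra `ℱ_n = σ(ξ₁, …, ξ_n)`. -/
@[reducible]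
def pastSigma {X : Type*} [MeasurableSpace X] (n : ℕ) : MeasurableSpace (ℕ → X) :=
  cylinderEvents {j : ℕ | j < n}

/-- The average run length `E_∞^{ν₀}[T]`, an extended nonnegative real number. -/
def arl {X : Type*} [MeasurableSpace X] (ν₀ : Measure X) (T : (ℕ → X) → ℕ∞) : ℝ≥0∞ :=
  ∫⁻ ω, (T ω : ℝ≥0∞) ∂(lawNoChange ν₀)

/-- Lorden's worst-case detection delay
`sup_{k ≥ 1} esssup E_k^{ν₀,ν₁}[(T - k + 1)⁺ | ℱ_{k-1}]`. The subtraction in `ℝ≥0∞` is truncated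
at `0`, so that it is the positive part. -/
def wdd {X : Type*} [MeasurableSpace X] (ν₀ ν₁ : Measure X) (T : (ℕ → X) → ℕ∞) : ℝ≥0∞ :=
  ⨆ (k : ℕ) (_ : 1 ≤ k),
    essSup (condLExp (pastSigma (k - 1)) (lawChange ν₀ ν₁ k)
      (fun ω => ((T ω : ℝ≥0∞) + 1) - (k : ℝ≥0∞))) (lawChange ν₀ ν₁ k)

/-! Gaussian mean shift. -/

/-- The squared Mahalanobis distance `(x - y)ᵀ Σ⁻¹ (x - y)`. -/
def mahalanobisSq {d : ℕ} (S : Matrix (Fin d) (Fin d) ℝ) (x y : EuclideanSpace ℝ (Fin d)) : ℝ :=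
  (x - y).ofLp ⬝ᵥ (S⁻¹ *ᵥ (x - y).ofLp)

/-- The Lebesgue density of `N(m, Σ)` at `x`, for `Σ` positive definite. -/
def gaussianDensity {d : ℕ} (m : EuclideanSpace ℝ (Fin d)) (S : Matrix (Fin d) (Fin d) ℝ)
    (x : EuclideanSpace ℝ (Fin d)) : ℝ :=
  (√((2 * Real.pi) ^ d * S.det))⁻¹ * Real.exp (-(1 / 2) * mahalanobisSq S x m)

/-- The log-likelihood ratio of `N(m₁, Σ)` against `N(m₀, Σ)`. -/
def logLR {d : ℕ} (S : Matrix (Fin d) (Fin d) ℝ) (m₀ m₁ : EuclideanSpace ℝ (Fin d))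
    (x : EuclideanSpace ℝ (Fin d)) : ℝ :=
  Real.log (gaussianDensity m₁ S x / gaussianDensity m₀ S x)

/-- The family `{N(m, Σ) : m ∈ M}`. -/
def gaussianFamily {d : ℕ} (S : Matrix (Fin d) (Fin d) ℝ) (M : Set (EuclideanSpace ℝ (Fin d))) :
    Set (Measure (EuclideanSpace ℝ (Fin d))) :=
  {ν | ∃ m ∈ M, ν = multivariateGaussian m S}

/-- `(m₀, m₁)` minimizes the squared Mahalanobis distance over `M₀ × M₁`. -/
def IsLeastFavorable {d : ℕ} (S : Matrix (Fin d) (Fin d) ℝ)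
    (M₀ M₁ : Set (EuclideanSpace ℝ (Fin d))) (m₀ m₁ : EuclideanSpace ℝ (Fin d)) : Prop :=
  m₀ ∈ M₀ ∧ m₁ ∈ M₁ ∧ ∀ x ∈ M₀, ∀ y ∈ M₁, mahalanobisSq S m₀ m₁ ≤ mahalanobisSq S x y

/-- `ε* = exp(-(1/8) (m₀ - m₁)ᵀ Σ⁻¹ (m₀ - m₁))`. -/
def epsStar {d : ℕ} (S : Matrix (Fin d) (Fin d) ℝ) (m₀ m₁ : EuclideanSpace ℝ (Fin d)) : ℝ :=
  Real.exp (-(1 / 8) * mahalanobisSq S m₀ m₁)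

/-- The detection procedure
`T₁ = inf {t > 0 : max_{1 ≤ k ≤ t} ∑_{i=k}^t (1/2) L*(ξ_i) ≥ b}`, with `inf ∅ = ∞`. -/
def T₁ {d : ℕ} (S : Matrix (Fin d) (Fin d) ℝ) (m₀ m₁ : EuclideanSpace ℝ (Fin d)) (b : ℝ)
    (ω : ℕ → EuclideanSpace ℝ (Fin d)) : ℕ∞ :=
  ⨅ (t : ℕ) (_ : 0 < t ∧ ∃ k : ℕ, 1 ≤ k ∧ k ≤ t ∧
    b ≤ ∑ i ∈ Finset.Icc k t, (1 / 2) * logLR S m₀ m₁ (obs i ω)), (t : ℕ∞)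

end RobustCusum

end

open RobustCusum

/-! Write `q` for the squared distance of the least favorable pair, so `ε* = exp (-q/8)`. The
log-likelihood ratio `L*` is affine with variance `q` under every `N(m, Σ)`, and its mean there is
`L*(m)`. First-order optimality of the pair (`normalVec_dotProduct_le`) gives mean at least `q/2` on
`M₁` and at most `-q/2` on `M₀`. Hence `exp (-L*/2)` has expectation at most `ε*` after the change,
and `exp L*` at most `1` before it.

Delay (`wdd_le_of_first_passage`): after the change, the walk with steps `L*/2` is still below `b`
at time `n` with probability at most `e^b ε*^n`, whatever the past. Summing these tails gives a
delay of at most `8b/q + O(1)`. As `1 - ε* < q/8` strictly, the `O(1)` is eventually absorbed and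
the `o(1)` can be taken to be zero.

Run length (`arl_ge_of_exists_increment`): an alarm by time `N` needs one of at most `N²` windows
with `∑ L* ≥ 2b`, each of probability at most `e^{-2b}`, so `b = log (3γ)` suffices. -/

namespace RobustCusum

/-! ### Delay and run-length bounds for general i.i.d. increments -/

section ProductMeasure

variable {X : Type*} [MeasurableSpace X]

/-- Chernoff bound for sums of independent coordinates of an infinite product. -/
theorem infinitePi_le_sum_le {μ : ℕ → Measure X} [∀ i, IsProbabilityMeasure (μ i)] {f : X → ℝ}
    (hf : Measurable f) (I : Finset ℕ) {a : ℝ≥0∞}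
    (ha : ∀ i ∈ I, ∫⁻ x, ENNReal.ofReal (Real.exp (f x)) ∂(μ i) ≤ a) (b : ℝ) :
    Measure.infinitePi μ {ω | b ≤ ∑ i ∈ I, f (ω i)} ≤
      ENNReal.ofReal (Real.exp (-b)) * a ^ I.card := by
  have hg : Measurable fun x => ENNReal.ofReal (Real.exp (f x)) := by fun_prop
  have hprod : ∫⁻ ω, ∏ i ∈ I, ENNReal.ofReal (Real.exp (f (ω i))) ∂(Measure.infinitePi μ) ≤
      a ^ I.card := by
    rw [lintegral_prod_eq_prod_lintegral_of_indepFun I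
      (fun i (ω : ℕ → X) => ENNReal.ofReal (Real.exp (f (ω i)))) (iIndepFun_infinitePi fun _ => hg)
      fun i => hg.comp (measurable_pi_apply i)]
    refine Finset.prod_le_pow_card _ _ _ fun i hi => ?_
    have h := ha i hi
    rwa [← Measure.infinitePi_map_eval μ i, lintegral_map hg (measurable_pi_apply i)] at h
  have hset : {ω : ℕ → X | b ≤ ∑ i ∈ I, f (ω i)} =
      {ω | ENNReal.ofReal (Real.exp b) ≤ ∏ i ∈ I, ENNReal.ofReal (Real.exp (f (ω i)))} := by
    ext ω
    simp only [Set.mem_ofPred_eq]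
    rw [← ENNReal.ofReal_prod_of_nonneg fun _ _ => (Real.exp_pos _).le, ← Real.exp_sum,
      ENNReal.ofReal_le_ofReal_iff (Real.exp_pos _).le, Real.exp_le_exp]
  rw [hset]
  have hmarkov := meas_ge_le_lintegral_div (μ := Measure.infinitePi μ)
    (f := fun ω => ∏ i ∈ I, ENNReal.ofReal (Real.exp (f (ω i))))
    (Finset.measurable_fun_prod I fun i _ => hg.comp (measurable_pi_apply i)).aemeasurable
    (ε := ENNReal.ofReal (Real.exp b)) (by simp [Real.exp_pos]) (by simp)
  refine hmarkov.trans ?_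
  rw [div_eq_mul_inv, mul_comm, Real.exp_neg, ENNReal.ofReal_inv_of_pos (Real.exp_pos _)]
  gcongr

/-- Conditioning on the first `n` coordinates does not affect a function of the others. -/
theorem condLExp_pastSigma_ae_eq {μ : ℕ → Measure X} [∀ i, IsProbabilityMeasure (μ i)] (n : ℕ)
    {g : (ℕ → X) → ℝ≥0∞} (hg : Measurable[cylinderEvents {j : ℕ | n ≤ j}] g) :
    condLExp (pastSigma n) (Measure.infinitePi μ) g =ᵐ[Measure.infinitePi μ]
      fun _ => ∫⁻ ω, g ω ∂(Measure.infinitePi μ) := by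
  have hpast : pastSigma n ≤ (MeasurableSpace.pi : MeasurableSpace (ℕ → X)) :=
    cylinderEvents_le_pi
  have hind : Indep (pastSigma n) (cylinderEvents {j : ℕ | n ≤ j}) (Measure.infinitePi μ) := by
    refine indep_iSup_of_disjoint (fun i => (measurable_pi_apply i).comap_le)
      (iIndepFun_infinitePi (X := fun _ => id) fun _ => measurable_id).iIndep ?_
    exact Set.disjoint_left.2 fun j (hj : j < n) (hj' : n ≤ j) => by omega
  refine (ae_eq_condLExp hpast _ _ measurable_const fun s hs => ?_).symm
  have h := lintegral_mul_eq_lintegral_mul_lintegral_of_independent_measurableSpace hpast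
    cylinderEvents_le_pi hind (Measurable.indicator (f := 1) (@measurable_const _ _ _ (pastSigma n) 1) hs) hg
  rw [lintegral_indicator_one (hpast s hs)] at h
  rw [setLIntegral_const, mul_comm, ← h, ← lintegral_indicator (hpast s hs)]
  congr with ω
  by_cases hω : ω ∈ s <;> simp [hω]

/-- Stated on an abstract space so that it can be applied with the σ-algebra of the post-change
coordinates. -/
theorem measurable_const_add_tsum_indicator {Ω : Type*} [MeasurableSpace Ω] {s : ℕ → Set Ω}
    (hs : ∀ j, MeasurableSet (s j)) (c : ℝ≥0∞) :
    Measurable fun ω => c + ∑' j, (s j).indicator (1 : Ω → ℝ≥0∞) ω :=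
  (Measurable.tsum fun j => measurable_one.indicator (hs j)).const_add c

/-- A procedure that stops no later than the first passage of the random walk of increments `f`
started at any time has worst-case detection delay bounded through the exponential moment of
`-f` after the change. -/
theorem wdd_le_of_first_passage {ν₀ ν₁ : Measure X} [IsProbabilityMeasure ν₀]
    [IsProbabilityMeasure ν₁] {f : X → ℝ} (hf : Measurable f) {a : ℝ≥0∞}
    (ha : ∫⁻ x, ENNReal.ofReal (Real.exp (-f x)) ∂ν₁ ≤ a) {b : ℝ} {N : ℕ} (hN : 0 < N)
    (hNb : ENNReal.ofReal (Real.exp b) * a ^ N ≤ 1) {T : (ℕ → X) → ℕ∞}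
    (hT : ∀ ω (k n : ℕ), 0 < n → b ≤ ∑ i ∈ Finset.Ico k (k + n), f (ω i) →
      T ω ≤ ((k + n : ℕ) : ℕ∞)) :
    wdd ν₀ ν₁ T ≤ N + (1 - a)⁻¹ := by
  refine iSup₂_le fun k hk => ?_
  obtain ⟨k, rfl⟩ : ∃ j, k = j + 1 := ⟨k - 1, by omega⟩
  simp only [Nat.add_sub_cancel]
  set μ : ℕ → Measure X := fun j => if j + 1 < k + 1 then ν₀ else ν₁ with hμ
  have : ∀ i, IsProbabilityMeasure (μ i) := fun i => by
    simp only [hμ]; split_ifs <;> infer_instance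
  change essSup (condLExp (pastSigma k) (Measure.infinitePi μ) _) (Measure.infinitePi μ) ≤ _
  -- Off `s j` the walk started at the change has passed `b` after `N + j` steps. So `g` dominates
  -- the delay, and it depends only on post-change coordinates.
  let s : ℕ → Set (ℕ → X) := fun j =>
    {ω | -b ≤ ∑ i ∈ Finset.Ico k (k + (N + j)), -f (ω i)}
  let g : (ℕ → X) → ℝ≥0∞ := fun ω => N + ∑' j, (s j).indicator 1 ω
  have hs : ∀ j, MeasurableSet[cylinderEvents {j : ℕ | k ≤ j}] (s j) := fun j => by
    refine measurableSet_le measurable_const (Finset.measurable_sum _ fun i hi => ?_)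
    refine (hf.comp ?_).neg
    exact measurable_cylinderEvent_apply (Finset.mem_Ico.1 hi).1
  have hg : Measurable[cylinderEvents {j : ℕ | k ≤ j}] g := by
    exact @measurable_const_add_tsum_indicator _ (cylinderEvents {j | k ≤ j}) _ hs _
  have hle : ∀ ω, ((T ω : ℝ≥0∞) + 1) - ((k + 1 : ℕ) : ℝ≥0∞) ≤ g ω := fun ω => by
    by_cases h : ∃ j, ω ∉ s j
    · classical
      have hj := Nat.find_spec h
      have hmin : ∀ i < Nat.find h, ω ∈ s i := fun i hi => not_not.1 (Nat.find_min h hi)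
      set j := Nat.find h
      have hTj := hT ω k (N + j) (by omega) (by
        simp only [s, Set.mem_ofPred_eq, Finset.sum_neg_distrib, neg_le_neg_iff, not_le] at hj
        exact hj.le)
      have hT' : (T ω : ℝ≥0∞) ≤ ((k + (N + j) : ℕ) : ℝ≥0∞) := by
        exact_mod_cast ENat.toENNReal_le.2 hTj
      have hsum : (j : ℝ≥0∞) ≤ ∑' i, (s i).indicator 1 ω := by
        refine le_trans ?_ (ENNReal.sum_le_tsum (Finset.range j))
        rw [Finset.sum_congr rfl fun i hi =>
          Set.indicator_of_mem (hmin i (Finset.mem_range.1 hi)) _]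
        simp
      rw [tsub_le_iff_right]
      calc (T ω : ℝ≥0∞) + 1 ≤ ((k + (N + j) : ℕ) : ℝ≥0∞) + 1 := by gcongr
        _ = N + j + ((k + 1 : ℕ) : ℝ≥0∞) := by push_cast; ring
        _ ≤ g ω + ((k + 1 : ℕ) : ℝ≥0∞) := by simp only [g]; gcongr
    · push Not at h
      have : g ω = ⊤ := by
        simp only [g]
        rw [tsum_congr fun j => Set.indicator_of_mem (h j) _]
        simp
      simp [this]
  -- The first `N` factors of `a` pay for `e^b`, which leaves a geometric tail.
  have hprob : ∀ j, Measure.infinitePi μ (s j) ≤ a ^ j := fun j => by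
    refine (infinitePi_le_sum_le (a := a) hf.neg (Finset.Ico k (k + (N + j)))
      (fun i hi => ?_) (-b)).trans ?_
    · have : μ i = ν₁ := by
        have := (Finset.mem_Ico.1 hi).1
        simp only [hμ]; rw [if_neg (by omega)]
      simpa [this] using ha
    · rw [Nat.card_Ico, neg_neg, show k + (N + j) - k = N + j by omega, pow_add, ← mul_assoc]
      exact mul_le_of_le_one_left' hNb
  have hint : ∫⁻ ω, g ω ∂(Measure.infinitePi μ) ≤ N + (1 - a)⁻¹ := by
    have hs' : ∀ j, MeasurableSet (s j) := fun j => cylinderEvents_le_pi _ (hs j)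
    rw [lintegral_add_left measurable_const, lintegral_const, lintegral_tsum fun j =>
      (measurable_one.indicator (hs' j)).aemeasurable, ← ENNReal.tsum_geometric]
    simp only [lintegral_indicator_one (hs' _), measure_univ, mul_one]
    gcongr with j
    exact hprob j
  refine essSup_le_of_ae_le _ ?_
  filter_upwards [condLExp_mono (mΩ := pastSigma k) (Eventually.of_forall hle),
    condLExp_pastSigma_ae_eq (μ := μ) k hg] with ω h₁ h₂
  exact h₁.trans (h₂.le.trans hint)

/-- A procedure that stops only when some increment of the random walk with steps `f` exceeds
`c` has average run length at least of order `exp (c / 2)` as soon as `exp ∘ f` has expectation at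
most one before the change. -/
theorem arl_ge_of_exists_increment {ν₀ : Measure X} [IsProbabilityMeasure ν₀] {f : X → ℝ}
    (hf : Measurable f) (ha : ∫⁻ x, ENNReal.ofReal (Real.exp (f x)) ∂ν₀ ≤ 1) {c γ : ℝ} (hγ : 0 < γ)
    (hc : 8 * γ ^ 2 ≤ Real.exp c) {T : (ℕ → X) → ℕ∞}
    (hT : ∀ ω (N : ℕ), T ω ≤ N → ∃ k < N, ∃ t < N, c ≤ ∑ i ∈ Finset.Icc k t, f (ω i)) :
    ENNReal.ofReal γ ≤ arl ν₀ T := by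
  set P := lawNoChange ν₀ with hP
  have : IsProbabilityMeasure P := by rw [hP, lawNoChange]; infer_instance
  -- With probability at least `1/2` there is no alarm by time `N`; then `T ≥ N + 1 ≥ 2γ`.
  set N := ⌊2 * γ⌋₊ with hN
  have hN1 : (N : ℝ) ≤ 2 * γ := Nat.floor_le (by positivity)
  have hN2 : 2 * γ ≤ N + 1 := (Nat.lt_floor_add_one _).le
  let A : Set (ℕ → X) := ⋃ k ∈ Finset.range N, ⋃ t ∈ Finset.range N,
    {ω | c ≤ ∑ i ∈ Finset.Icc k t, f (ω i)}
  have hA : MeasurableSet A := by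
    refine Finset.measurableSet_biUnion _ fun k _ => Finset.measurableSet_biUnion _ fun t _ => ?_
    exact measurableSet_le measurable_const (by fun_prop)
  have hPA : P A ≤ ENNReal.ofReal (1 / 2) := by
    calc P A ≤ ∑ k ∈ Finset.range N, ∑ t ∈ Finset.range N, ENNReal.ofReal (Real.exp (-c)) := by
          refine (measure_biUnion_finset_le _ _).trans (Finset.sum_le_sum fun k _ => ?_)
          refine (measure_biUnion_finset_le _ _).trans (Finset.sum_le_sum fun t _ => ?_)
          simpa [hP, lawNoChange] using infinitePi_le_sum_le (μ := fun _ => ν₀) hf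
            (Finset.Icc k t) (fun _ _ => ha) c
      _ = ENNReal.ofReal (N * (N * Real.exp (-c))) := by
          rw [ENNReal.ofReal_mul (by positivity), ENNReal.ofReal_mul (by positivity)]
          simp
      _ ≤ ENNReal.ofReal (1 / 2) := by
          refine ENNReal.ofReal_le_ofReal ?_
          rw [Real.exp_neg, ← mul_assoc, ← div_eq_mul_inv, div_le_iff₀ (Real.exp_pos _)]
          nlinarith [(Nat.cast_nonneg N : (0 : ℝ) ≤ N)]
  have hPAc : ENNReal.ofReal (1 / 2) ≤ P Aᶜ := by
    rw [prob_compl_eq_one_sub hA]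
    refine le_trans ?_ (tsub_le_tsub_left hPA 1)
    rw [← ENNReal.ofReal_one, ← ENNReal.ofReal_sub _ (by norm_num)]
    exact ENNReal.ofReal_le_ofReal (by norm_num)
  calc ENNReal.ofReal γ ≤ ENNReal.ofReal ((N + 1) * (1 / 2)) :=
        ENNReal.ofReal_le_ofReal (by linarith)
    _ = ((N + 1 : ℕ) : ℝ≥0∞) * ENNReal.ofReal (1 / 2) := by
        rw [ENNReal.ofReal_mul (by positivity)]
        congr 1
        exact_mod_cast ENNReal.ofReal_natCast (N + 1)
    _ ≤ ((N + 1 : ℕ) : ℝ≥0∞) * P Aᶜ := by gcongr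
    _ = ∫⁻ ω in Aᶜ, ((N + 1 : ℕ) : ℝ≥0∞) ∂P := by rw [setLIntegral_const]
    _ ≤ ∫⁻ ω in Aᶜ, (T ω : ℝ≥0∞) ∂P := by
        refine setLIntegral_mono' hA.compl fun ω hω => ?_
        have hlt : (N : ℕ∞) < T ω := by
          by_contra! hle
          obtain ⟨k, hk, t, ht, h⟩ := hT ω N hle
          exact hω (Set.mem_biUnion (Finset.mem_range.2 hk)
            (Set.mem_biUnion (Finset.mem_range.2 ht) h))
        have := Order.add_one_le_of_lt hlt
        exact_mod_cast ENat.toENNReal_le.2 this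
    _ ≤ arl ν₀ T := setLIntegral_le_lintegral _ _

end ProductMeasure

/-! ### Gaussian exponential moments and the geometry of the least favorable pair -/

section Gaussian

variable {d : ℕ}

/-- Exponential moments of affine functions of a Gaussian vector. -/
theorem lintegral_exp_affine_multivariateGaussian {S : Matrix (Fin d) (Fin d) ℝ}
    (hS : S.PosSemidef) (m v : EuclideanSpace ℝ (Fin d)) (c : ℝ) :
    ∫⁻ x, ENNReal.ofReal (Real.exp (v.ofLp ⬝ᵥ x.ofLp + c)) ∂(multivariateGaussian m S) =
      ENNReal.ofReal
        (Real.exp (v.ofLp ⬝ᵥ m.ofLp + c + (v.ofLp ⬝ᵥ (S *ᵥ v.ofLp)) / 2)) := by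
  have hin : ∀ x : EuclideanSpace ℝ (Fin d), v.ofLp ⬝ᵥ x.ofLp = innerSL ℝ v x := fun x => by
    simp [PiLp.inner_apply, dotProduct, mul_comm]
  have hmap := IsGaussian.map_eq_gaussianReal (μ := multivariateGaussian m S) (innerSL ℝ v)
  have hmean : ∫ x, innerSL ℝ v x ∂(multivariateGaussian m S) = v.ofLp ⬝ᵥ m.ofLp := by
    rw [(innerSL ℝ v).integral_comp_comm IsGaussian.integrable_fun_id,
      integral_id_multivariateGaussian, hin]
  have hvar : Var[innerSL ℝ v; multivariateGaussian m S] = v.ofLp ⬝ᵥ (S *ᵥ v.ofLp) := by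
    rw [← covarianceBilin_multivariateGaussian (μ := m) hS v v,
      covarianceBilin_self IsGaussian.memLp_two_id]
    rfl
  have hq : 0 ≤ v.ofLp ⬝ᵥ (S *ᵥ v.ofLp) := hvar ▸ variance_nonneg _ _
  rw [hmean, hvar] at hmap
  rw [lintegral_congr fun x => by rw [hin x], ← lintegral_map (μ := multivariateGaussian m S) (g := innerSL ℝ v)
    (f := fun y : ℝ => ENNReal.ofReal (Real.exp (y + c))) (by fun_prop) (by fun_prop), hmap]
  simp_rw [Real.exp_add _ c]
  have hint := integrable_exp_mul_gaussianReal (μ := v.ofLp ⬝ᵥ m.ofLp)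
    (v := (v.ofLp ⬝ᵥ (S *ᵥ v.ofLp)).toNNReal) 1
  simp only [one_mul] at hint
  rw [← ofReal_integral_eq_lintegral_ofReal (hint.mul_const _)
    (Eventually.of_forall fun y => by positivity), integral_mul_const]
  have hmgf := congrFun (mgf_fun_id_gaussianReal (μ := v.ofLp ⬝ᵥ m.ofLp)
    (v := (v.ofLp ⬝ᵥ (S *ᵥ v.ofLp)).toNNReal)) 1
  simp only [mgf, one_mul] at hmgf
  rw [hmgf, ← Real.exp_add, Real.coe_toNNReal _ hq]
  ring_nf

/-- The normal vector `Σ⁻¹ (m₁ - m₀)` of the hyperplanes on which the likelihood ratio is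
constant. -/
noncomputable def normalVec (S : Matrix (Fin d) (Fin d) ℝ) (m₀ m₁ : EuclideanSpace ℝ (Fin d)) :
    EuclideanSpace ℝ (Fin d) :=
  WithLp.toLp 2 (S⁻¹ *ᵥ (m₁ - m₀).ofLp)

variable {S : Matrix (Fin d) (Fin d) ℝ}

theorem dotProduct_inv_mulVec_comm (hS : S.PosDef) (x y : Fin d → ℝ) :
    x ⬝ᵥ (S⁻¹ *ᵥ y) = y ⬝ᵥ (S⁻¹ *ᵥ x) := by
  have h : (S⁻¹)ᵀ = S⁻¹ := by
    simpa only [Matrix.conjTranspose_eq_transpose_of_trivial] using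
      hS.inv.isHermitian.eq
  rw [Matrix.dotProduct_mulVec, ← Matrix.mulVec_transpose, h, dotProduct_comm]

theorem mahalanobisSq_nonneg (hS : S.PosDef) (x y : EuclideanSpace ℝ (Fin d)) :
    0 ≤ mahalanobisSq S x y := by
  simpa [mahalanobisSq] using hS.inv.posSemidef.dotProduct_mulVec_nonneg (x - y).ofLp

theorem normalVec_dotProduct_sub (m₀ m₁ : EuclideanSpace ℝ (Fin d)) :
    (normalVec S m₀ m₁).ofLp ⬝ᵥ m₁.ofLp - (normalVec S m₀ m₁).ofLp ⬝ᵥ m₀.ofLp =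
      mahalanobisSq S m₀ m₁ := by
  rw [← dotProduct_sub, dotProduct_comm, mahalanobisSq, ← neg_sub m₁ m₀,
    WithLp.ofLp_neg, Matrix.mulVec_neg, neg_dotProduct_neg]
  rfl

/-- This is the variance of `L*` under `N(m, Σ)`, for any `m`. -/
theorem normalVec_dotProduct_mulVec (hS : S.PosDef) (m₀ m₁ : EuclideanSpace ℝ (Fin d)) :
    (normalVec S m₀ m₁).ofLp ⬝ᵥ (S *ᵥ (normalVec S m₀ m₁).ofLp) = mahalanobisSq S m₀ m₁ := by
  have h : S *ᵥ (normalVec S m₀ m₁).ofLp = (m₁ - m₀).ofLp := by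
    simp [normalVec, Matrix.mulVec_mulVec, Matrix.mul_nonsing_inv _
      ((Matrix.isUnit_iff_isUnit_det _).1 hS.isUnit)]
  rw [h, WithLp.ofLp_sub, dotProduct_sub, normalVec_dotProduct_sub]

/-- The log-likelihood ratio is affine. -/
theorem logLR_eq (hS : S.PosDef) (m₀ m₁ x : EuclideanSpace ℝ (Fin d)) :
    logLR S m₀ m₁ x = (normalVec S m₀ m₁).ofLp ⬝ᵥ x.ofLp -
      ((normalVec S m₀ m₁).ofLp ⬝ᵥ m₀.ofLp + (normalVec S m₀ m₁).ofLp ⬝ᵥ m₁.ofLp) / 2 := by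
  have hdet := hS.det_pos
  have hc : (√((2 * Real.pi) ^ d * S.det))⁻¹ ≠ 0 := by positivity
  rw [logLR, gaussianDensity, gaussianDensity, mul_div_mul_left _ _ hc, ← Real.exp_sub,
    Real.log_exp]
  simp only [mahalanobisSq, normalVec, WithLp.ofLp_sub, Matrix.mulVec_sub, dotProduct_sub,
    sub_dotProduct, ← dotProduct_comm (_ *ᵥ _)]
  simp only [dotProduct_comm (_ *ᵥ _), dotProduct_inv_mulVec_comm hS m₁.ofLp x.ofLp,
    dotProduct_inv_mulVec_comm hS m₀.ofLp x.ofLp, dotProduct_inv_mulVec_comm hS m₀.ofLp m₁.ofLp]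
  ring

theorem measurable_logLR (hS : S.PosDef) (m₀ m₁ : EuclideanSpace ℝ (Fin d)) :
    Measurable (logLR S m₀ m₁) := by
  have : logLR S m₀ m₁ = fun x => (normalVec S m₀ m₁).ofLp ⬝ᵥ x.ofLp -
      ((normalVec S m₀ m₁).ofLp ⬝ᵥ m₀.ofLp + (normalVec S m₀ m₁).ofLp ⬝ᵥ m₁.ofLp) / 2 :=
    funext (logLR_eq hS m₀ m₁)
  rw [this]
  simp only [dotProduct]
  fun_prop

/-- Exponential moments of the log-likelihood ratio. -/
theorem lintegral_exp_mul_logLR (hS : S.PosDef) (m₀ m₁ m : EuclideanSpace ℝ (Fin d)) (t : ℝ) :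
    ∫⁻ x, ENNReal.ofReal (Real.exp (t * logLR S m₀ m₁ x)) ∂(multivariateGaussian m S) =
      ENNReal.ofReal
        (Real.exp (t * logLR S m₀ m₁ m + t ^ 2 * mahalanobisSq S m₀ m₁ / 2)) := by
  have h := lintegral_exp_affine_multivariateGaussian hS.posSemidef m (t • normalVec S m₀ m₁)
    (-(t * (((normalVec S m₀ m₁).ofLp ⬝ᵥ m₀.ofLp + (normalVec S m₀ m₁).ofLp ⬝ᵥ m₁.ofLp) / 2)))
  simp only [WithLp.ofLp_smul, smul_dotProduct, dotProduct_smul, Matrix.mulVec_smul, smul_eq_mul,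
    normalVec_dotProduct_mulVec hS, ← sub_eq_add_neg, ← mul_sub, ← logLR_eq hS] at h
  rw [h]
  ring_nf

/-- Divide by `t` and let `t` decrease to `0`. -/
theorem nonneg_of_forall_mul_add_sq {a c : ℝ}
    (h : ∀ t ∈ Set.Ioo (0 : ℝ) 1, 0 ≤ 2 * t * a + t ^ 2 * c) :
    0 ≤ a := by
  have hlim : Tendsto (fun t : ℝ => 2 * a + t * c) (𝓝[>] 0) (𝓝 (2 * a + 0 * c)) :=
    ((continuous_const.add (continuous_id.mul continuous_const)).tendsto 0).mono_left
      nhdsWithin_le_nhds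
  have : 0 ≤ 2 * a + 0 * c := by
    refine ge_of_tendsto hlim ?_
    filter_upwards [Ioo_mem_nhdsGT (zero_lt_one' ℝ)] with t ht
    have := h t ht
    have ht0 := ht.1
    by_contra! hneg
    nlinarith
  linarith

theorem mahalanobisSq_symm (x y : EuclideanSpace ℝ (Fin d)) :
    mahalanobisSq S x y = mahalanobisSq S y x := by
  rw [mahalanobisSq, mahalanobisSq, ← neg_sub y x, WithLp.ofLp_neg, Matrix.mulVec_neg,
    neg_dotProduct_neg]

/-- First-order optimality of the nearest point of a convex set. -/
theorem normalVec_dotProduct_le (hS : S.PosDef) {M : Set (EuclideanSpace ℝ (Fin d))}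
    (hM : Convex ℝ M) {m₀ m₁ y : EuclideanSpace ℝ (Fin d)} (hm₁ : m₁ ∈ M) (hy : y ∈ M)
    (hmin : ∀ z ∈ M, mahalanobisSq S m₀ m₁ ≤ mahalanobisSq S m₀ z) :
    (normalVec S m₀ m₁).ofLp ⬝ᵥ m₁.ofLp ≤ (normalVec S m₀ m₁).ofLp ⬝ᵥ y.ofLp := by
  rw [← sub_nonneg, ← dotProduct_sub]
  refine nonneg_of_forall_mul_add_sq (c := mahalanobisSq S y m₁) fun t ht => ?_
  have h := hmin (m₁ + t • (y - m₁)) (hM.add_smul_sub_mem hm₁ hy ⟨ht.1.le, ht.2.le⟩)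
  rw [mahalanobisSq_symm m₀ m₁, mahalanobisSq_symm m₀] at h
  -- Expansion along the segment from `m₁` to `y`; minimality makes the last two terms nonnegative
  -- together.
  have key : mahalanobisSq S (m₁ + t • (y - m₁)) m₀ = mahalanobisSq S m₁ m₀ +
      2 * t * ((normalVec S m₀ m₁).ofLp ⬝ᵥ (y.ofLp - m₁.ofLp)) + t ^ 2 * mahalanobisSq S y m₁ := by
    have hdecomp : m₁ + t • (y - m₁) - m₀ = (m₁ - m₀) + t • (y - m₁) := by abel
    rw [mahalanobisSq, hdecomp, mahalanobisSq, mahalanobisSq, ← WithLp.ofLp_sub 2 y m₁]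
    simp only [WithLp.ofLp_add, WithLp.ofLp_smul, Matrix.mulVec_add, dotProduct_add,
      add_dotProduct, Matrix.mulVec_smul, dotProduct_smul, smul_dotProduct, smul_eq_mul, normalVec,
      dotProduct_comm (S⁻¹ *ᵥ (m₁ - m₀).ofLp)]
    rw [dotProduct_inv_mulVec_comm hS (m₁ - m₀).ofLp (y - m₁).ofLp]
    ring
  linarith

variable {M₀ M₁ : Set (EuclideanSpace ℝ (Fin d))} {m₀ m₁ : EuclideanSpace ℝ (Fin d)}

/-- `M₁` lies beyond its supporting hyperplane at `m₁`, on which `L*` equals `q/2`. -/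
theorem IsLeastFavorable.le_logLR (hS : S.PosDef) (hM₁ : Convex ℝ M₁)
    (hm : IsLeastFavorable S M₀ M₁ m₀ m₁) {y : EuclideanSpace ℝ (Fin d)} (hy : y ∈ M₁) :
    mahalanobisSq S m₀ m₁ / 2 ≤ logLR S m₀ m₁ y := by
  have h := normalVec_dotProduct_le hS hM₁ hm.2.1 hy fun z hz => hm.2.2 m₀ hm.1 z hz
  rw [logLR_eq hS, ← normalVec_dotProduct_sub]
  linarith

/-- The same argument with the roles exchanged, which reverses the normal vector. -/
theorem IsLeastFavorable.logLR_le (hS : S.PosDef) (hM₀ : Convex ℝ M₀)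
    (hm : IsLeastFavorable S M₀ M₁ m₀ m₁) {x : EuclideanSpace ℝ (Fin d)} (hx : x ∈ M₀) :
    logLR S m₀ m₁ x ≤ -(mahalanobisSq S m₀ m₁ / 2) := by
  have h := normalVec_dotProduct_le (m₀ := m₁) hS hM₀ hm.1 hx fun z hz => by
    rw [mahalanobisSq_symm m₁, mahalanobisSq_symm m₁]
    exact hm.2.2 z hz m₁ hm.2.1
  have hneg : normalVec S m₁ m₀ = -normalVec S m₀ m₁ := by
    ext i
    simp only [normalVec, ← neg_sub m₁ m₀, WithLp.ofLp_neg, Matrix.mulVec_neg]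
  rw [hneg, WithLp.ofLp_neg, neg_dotProduct, neg_dotProduct] at h
  rw [logLR_eq hS, ← normalVec_dotProduct_sub]
  linarith

end Gaussian

/-! ### Application to the CUSUM procedure `T₁` -/

section Cusum

variable {d : ℕ} {S : Matrix (Fin d) (Fin d) ℝ} {m₀ m₁ : EuclideanSpace ℝ (Fin d)}

theorem sum_Icc_obs {X : Type*} (g : X → ℝ) (ω : ℕ → X) (k t : ℕ) :
    ∑ i ∈ Finset.Icc (k + 1) (t + 1), g (obs i ω) = ∑ i ∈ Finset.Icc k t, g (ω i) := by
  rw [← Finset.map_add_right_Icc k t 1, Finset.sum_map]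
  rfl

theorem T₁_le_of_le_sum {b : ℝ} (ω : ℕ → EuclideanSpace ℝ (Fin d)) (k n : ℕ) (hn : 0 < n)
    (h : b ≤ ∑ i ∈ Finset.Ico k (k + n), 1 / 2 * logLR S m₀ m₁ (ω i)) :
    T₁ S m₀ m₁ b ω ≤ ((k + n : ℕ) : ℕ∞) := by
  obtain ⟨n, rfl⟩ : ∃ j, n = j + 1 := ⟨n - 1, by omega⟩
  have hI : Finset.Ico k (k + (n + 1)) = Finset.Icc k (k + n) := by
    ext i; simp only [Finset.mem_Ico, Finset.mem_Icc]; omega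
  refine iInf₂_le (k + (n + 1)) ⟨by omega, k + 1, by omega, by omega, ?_⟩
  rw [← add_assoc, sum_Icc_obs (fun x => 1 / 2 * logLR S m₀ m₁ x)]
  rwa [hI] at h

/-- Clearing the factor `1/2` doubles the threshold, so that the moment bound for `exp L*` applies.
-/
theorem exists_le_sum_of_T₁_le {b : ℝ} (ω : ℕ → EuclideanSpace ℝ (Fin d)) (N : ℕ)
    (h : T₁ S m₀ m₁ b ω ≤ N) :
    ∃ k < N, ∃ t < N, 2 * b ≤ ∑ i ∈ Finset.Icc k t, logLR S m₀ m₁ (ω i) := by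
  by_contra! hcon
  have hlt : ((N + 1 : ℕ) : ℕ∞) ≤ T₁ S m₀ m₁ b ω := by
    refine le_iInf₂ fun t ht => ?_
    obtain ⟨ht0, k, hk, hkt, hb⟩ := ht
    rw [Nat.cast_le]
    by_contra! htN
    obtain ⟨k, rfl⟩ : ∃ j, k = j + 1 := ⟨k - 1, by omega⟩
    obtain ⟨t, rfl⟩ : ∃ j, t = j + 1 := ⟨t - 1, by omega⟩
    rw [sum_Icc_obs (fun x => 1 / 2 * logLR S m₀ m₁ x), ← Finset.mul_sum] at hb
    have := hcon k (by omega) t (by omega)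
    linarith
  have := Nat.cast_le.1 (hlt.trans h)
  omega

variable {M₀ M₁ : Set (EuclideanSpace ℝ (Fin d))}

theorem ofReal_le_arl_T₁ (hS : S.PosDef) (hM₀ : Convex ℝ M₀)
    (hm : IsLeastFavorable S M₀ M₁ m₀ m₁) {ν₀ : Measure (EuclideanSpace ℝ (Fin d))}
    (hν₀ : ν₀ ∈ gaussianFamily S M₀) {γ : ℝ} (hγ : 0 < γ) :
    ENNReal.ofReal γ ≤ arl ν₀ (T₁ S m₀ m₁ (Real.log γ + Real.log 3)) := by
  obtain ⟨x, hx, rfl⟩ := hν₀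
  refine arl_ge_of_exists_increment (c := 2 * (Real.log γ + Real.log 3))
    (measurable_logLR hS m₀ m₁) ?_ hγ ?_ exists_le_sum_of_T₁_le
  · have h := lintegral_exp_mul_logLR hS m₀ m₁ x 1
    simp only [one_mul, one_pow] at h
    rw [h, ← ENNReal.ofReal_one, ← Real.exp_zero]
    refine ENNReal.ofReal_le_ofReal (Real.exp_le_exp.2 ?_)
    linarith [hm.logLR_le hS hM₀ hx]
  -- The constant `3` works because `(3γ)² = 9γ² ≥ 8γ²`.
  · rw [two_mul, Real.exp_add, Real.exp_add, Real.exp_log hγ, Real.exp_log (by norm_num)]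
    nlinarith [sq_nonneg γ]

/-- Since `-log ε* = q/8`, the least `N` with `e^b ε*^N ≤ 1` is `⌈8b/q⌉`. -/
theorem wdd_T₁_le (hS : S.PosDef) (hM₁ : Convex ℝ M₁)
    (hm : IsLeastFavorable S M₀ M₁ m₀ m₁) (hq : 0 < mahalanobisSq S m₀ m₁)
    {ν₀ ν₁ : Measure (EuclideanSpace ℝ (Fin d))} (hν₀ : ν₀ ∈ gaussianFamily S M₀)
    (hν₁ : ν₁ ∈ gaussianFamily S M₁) {b : ℝ} (hb : 0 < b) :
    wdd ν₀ ν₁ (T₁ S m₀ m₁ b) ≤ ENNReal.ofReal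
      (8 / mahalanobisSq S m₀ m₁ * b + (1 + (1 - epsStar S m₀ m₁)⁻¹)) := by
  obtain ⟨x, -, rfl⟩ := hν₀
  obtain ⟨y, hy, rfl⟩ := hν₁
  set q := mahalanobisSq S m₀ m₁ with hqdef
  have hε : epsStar S m₀ m₁ < 1 := by
    rw [epsStar, Real.exp_lt_one_iff]
    linarith
  have hε0 : 0 ≤ epsStar S m₀ m₁ := (Real.exp_pos _).le
  have hN : 8 / q * b ≤ ⌈8 / q * b⌉₊ := Nat.le_ceil _
  have h := wdd_le_of_first_passage (ν₀ := multivariateGaussian x S)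
    (ν₁ := multivariateGaussian y S) (f := fun z => 1 / 2 * logLR S m₀ m₁ z)
    (a := ENNReal.ofReal (epsStar S m₀ m₁)) (b := b) (N := ⌈8 / q * b⌉₊)
    ((measurable_logLR hS m₀ m₁).const_mul _) ?_ (Nat.ceil_pos.2 (by positivity)) ?_
    T₁_le_of_le_sum
  · refine h.trans ?_
    rw [← ENNReal.ofReal_one, ← ENNReal.ofReal_sub _ hε0,
      ← ENNReal.ofReal_inv_of_pos (by linarith), ← ENNReal.ofReal_natCast,
      ← ENNReal.ofReal_add (by positivity) (inv_nonneg.2 (by linarith))]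
    refine ENNReal.ofReal_le_ofReal ?_
    linarith [Nat.ceil_lt_add_one (show 0 ≤ 8 / q * b by positivity)]
  -- The exponent is at most `-q/4 + q/8 = -q/8`.
  · have h := lintegral_exp_mul_logLR hS m₀ m₁ y (-(1 / 2))
    simp only [neg_mul] at h ⊢
    rw [h]
    refine ENNReal.ofReal_le_ofReal (Real.exp_le_exp.2 ?_)
    have := hm.le_logLR hS hM₁ hy
    rw [← hqdef] at this ⊢
    linarith
  · rw [← ENNReal.ofReal_pow hε0, ← ENNReal.ofReal_mul (Real.exp_pos _).le,
      epsStar, ← Real.exp_nat_mul, ← Real.exp_add]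
    refine ENNReal.ofReal_le_one.2 (Real.exp_le_one_iff.2 ?_)
    rw [← hqdef]
    have h8 : 8 / q * b * q = 8 * b := by field_simp
    have := mul_le_mul_of_nonneg_right hN hq.le
    linarith

theorem eventually_mul_add_le_mul {A B : ℝ} (hAB : A < B) (c K : ℝ) :
    ∀ᶠ x : ℝ in atTop, A * (x + c) + K ≤ B * x := by
  filter_upwards [eventually_ge_atTop ((A * c + K) / (B - A))] with x hx
  rw [div_le_iff₀ (by linarith)] at hx
  linarith

/-- The detection delay is eventually at most `x / (1 - ε*)` when the threshold is within a
bounded distance of `x`. -/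
theorem eventually_wdd_T₁_le (hS : S.PosDef) (hM₁ : Convex ℝ M₁)
    (hm : IsLeastFavorable S M₀ M₁ m₀ m₁) {ν₀ ν₁ : Measure (EuclideanSpace ℝ (Fin d))}
    (hν₀ : ν₀ ∈ gaussianFamily S M₀) (hν₁ : ν₁ ∈ gaussianFamily S M₁) (c : ℝ) :
    ∀ᶠ x : ℝ in atTop, wdd ν₀ ν₁ (T₁ S m₀ m₁ (x + c)) ≤
      ENNReal.ofReal x / ENNReal.ofReal (1 - epsStar S m₀ m₁) := by
  rcases (mahalanobisSq_nonneg hS m₀ m₁).eq_or_lt with hq | hq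
  -- Here `ε* = 1`, and `x / 0 = ⊤` in `ℝ≥0∞` needs `x > 0`.
  · filter_upwards [eventually_gt_atTop 0] with x hx
    have : epsStar S m₀ m₁ = 1 := by simp [epsStar, ← hq]
    simp [this, ENNReal.div_zero, hx]
  -- Strictness leaves a gap between the two slopes that absorbs `c` and the additive constant.
  · have hlt : 1 - epsStar S m₀ m₁ < mahalanobisSq S m₀ m₁ / 8 := by
      have := Real.add_one_lt_exp (x := -(1 / 8) * mahalanobisSq S m₀ m₁) (by linarith)
      rw [epsStar]
      linarith
    have hpos : 0 < 1 - epsStar S m₀ m₁ := by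
      rw [epsStar, sub_pos, Real.exp_lt_one_iff]
      linarith
    have hAB : 8 / mahalanobisSq S m₀ m₁ < (1 - epsStar S m₀ m₁)⁻¹ := by
      rw [← inv_div]
      exact inv_strictAnti₀ hpos hlt
    filter_upwards [eventually_mul_add_le_mul hAB c (1 + (1 - epsStar S m₀ m₁)⁻¹),
      eventually_gt_atTop (-c)] with x hx hxc
    refine (wdd_T₁_le hS hM₁ hm hq hν₀ hν₁ (by linarith)).trans ?_
    rw [← ENNReal.ofReal_div_of_pos hpos, div_eq_inv_mul x]
    exact ENNReal.ofReal_le_ofReal hx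

end Cusum

end RobustCusum

theorem theorem2 {d : ℕ} (S : Matrix (Fin d) (Fin d) ℝ) (hS : S.PosDef)
    (M₀ M₁ : Set (EuclideanSpace ℝ (Fin d))) (hM₀ : Convex ℝ M₀) (hM₁ : Convex ℝ M₁)
    (m₀ m₁ : EuclideanSpace ℝ (Fin d)) (hm : IsLeastFavorable S M₀ M₁ m₀ m₁) :
    -- detection delay as the threshold tends to infinity
    (∀ ν₀ ∈ gaussianFamily S M₀, ∀ ν₁ ∈ gaussianFamily S M₁,
      ∃ r : ℝ → ℝ, Tendsto r atTop (𝓝 0) ∧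
        ∀ᶠ b : ℝ in atTop,
          wdd ν₀ ν₁ (T₁ S m₀ m₁ b) ≤
            ENNReal.ofReal b / ENNReal.ofReal (1 - epsStar S m₀ m₁) * ENNReal.ofReal (1 + r b)) ∧
    -- a choice of thresholds achieving the run-length constraint and the delay bound
    (∃ b : ℝ → ℝ,
      (∀ γ : ℝ, 0 < γ → ∀ ν₀ ∈ gaussianFamily S M₀,
        ENNReal.ofReal γ ≤ arl ν₀ (T₁ S m₀ m₁ (b γ))) ∧
      ∀ ν₀ ∈ gaussianFamily S M₀, ∀ ν₁ ∈ gaussianFamily S M₁,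
        ∃ r : ℝ → ℝ, Tendsto r atTop (𝓝 0) ∧
          ∀ᶠ γ : ℝ in atTop,
            wdd ν₀ ν₁ (T₁ S m₀ m₁ (b γ)) ≤
              ENNReal.ofReal (Real.log γ) / ENNReal.ofReal (1 - epsStar S m₀ m₁) *
                ENNReal.ofReal (1 + r γ)) := by
  refine ⟨fun ν₀ hν₀ ν₁ hν₁ => ⟨fun _ => 0, tendsto_const_nhds, ?_⟩,
    fun γ => Real.log γ + Real.log 3, fun γ hγ ν₀ hν₀ => ofReal_le_arl_T₁ hS hM₀ hm hν₀ hγ,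
    fun ν₀ hν₀ ν₁ hν₁ => ⟨fun _ => 0, tendsto_const_nhds, ?_⟩⟩
  · simpa using eventually_wdd_T₁_le hS hM₁ hm hν₀ hν₁ 0
  · simpa using Real.tendsto_log_atTop.eventually
      (eventually_wdd_T₁_le hS hM₁ hm hν₀ hν₁ (Real.log 3))
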